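/- Let $n\ge 1$, let $\xi_1,\dots,\xi_n$ be nonzero real numbers and let $p_1,\dots,p_n,q_1,\dots,q_n$ be integers such that $p_i>|q_i|>0$ for all $1\le i\le n$ and the rational numbers $\frac{p_1}{q_1},\dots,\frac{p_n}{q_n}$ are pairwise distinct. Assume that $\xi_1$ is irrational or $p_1/q_1\notin\mathbb{Z}$. Then, for every integer $M\ge 1$, there exists an integer $l$ such that \[ \limsup_{k\to\infty}\left\{\sum_{i=1}^n\xi_i\left(\frac{p_i}{q_i}\right)^{kM+l}\right\}-\liminf_{k\to\infty}\left\{\sum_{i=1}^n\xi_i\left(\frac{p_i}{q_i}\right)^{kM+l}\right\}\ge\frac{1}{p_1\cdots p_n}, \] where $\{x\}=x-\lfloor x\rfloor$ denotes the fractional part of a real number $x$. -/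

import Mathlib

open Filter

open Polynomial

/-! Put y_k = ∑ ξ_i (p_i/q_i)^k, e_k = {y_k}, P = ∏ p_i and T = ∏ (p_i - q_i S), with S the shift. T
kills y, so s = T e = -T⌊y⌋ is integer-valued and bounded, hence takes finitely many values. As
|q_i| < p_i, geometric series invert T on bounded sequences: e_k is determined by s_k, s_{k+1}, ...,
where s_k has weight 1/P and remote terms hardly count (`exists_abs_prod_mul_sub_le`). If s were
eventually periodic, so would be y modulo 1, which `not_forall_sub_int` excludes. Hence there are
far positions k ≡ k' mod M with s_k ≠ s_k' followed by equal long words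
(`exists_agree_of_not_eventually_periodic`), and P |e_k - e_k'| is nearly |s_k - s_k'| ≥ 1. -/

/-! ### Integer polynomials in the shift -/

/-- The shift operator on real sequences. -/
noncomputable def seqShift : Module.End ℝ (ℕ → ℝ) where
  toFun u k := u (k + 1)
  map_add' _ _ := rfl
  map_smul' _ _ := rfl

/-- The action of an integer polynomial on real sequences, the variable acting as the shift. -/
noncomputable def polyAct (Q : ℤ[X]) : Module.End ℝ (ℕ → ℝ) := aeval seqShift Q

/-- The integer polynomial `∏ i ∈ s, (p i - q i X)`. -/
noncomputable def linProd {ι : Type*} (p q : ι → ℤ) (s : Finset ι) : ℤ[X] :=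
  ∏ i ∈ s, (C (p i) - C (q i) * X)

lemma polyAct_add (Q R : ℤ[X]) (u : ℕ → ℝ) : polyAct (Q + R) u = polyAct Q u + polyAct R u := by
  simp [polyAct]

lemma polyAct_mul (Q R : ℤ[X]) (u : ℕ → ℝ) : polyAct (Q * R) u = polyAct Q (polyAct R u) := by
  simp [polyAct]

lemma polyAct_one (u : ℕ → ℝ) : polyAct 1 u = u := by
  simp [polyAct]

lemma polyAct_C (c : ℤ) (u : ℕ → ℝ) (k : ℕ) : polyAct (C c) u k = c * u k := by
  simp [polyAct]

lemma polyAct_X (u : ℕ → ℝ) (k : ℕ) : polyAct X u k = u (k + 1) := by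
  simp [polyAct, seqShift]

lemma polyAct_linear (a b : ℤ) (u : ℕ → ℝ) (k : ℕ) :
    polyAct (C a - C b * X) u k = a * u k - b * u (k + 1) := by
  have h : (C a - C b * X : ℤ[X]) = C a + C (-b) * X := by simp [sub_eq_add_neg]
  rw [h, polyAct_add, polyAct_mul, Pi.add_apply, polyAct_C, polyAct_C, polyAct_X]
  push_cast
  ring

lemma polyAct_shift (Q : ℤ[X]) (u : ℕ → ℝ) (a k : ℕ) :
    polyAct Q (fun j => u (a + j)) k = polyAct Q u (a + k) := by
  induction Q using Polynomial.induction_on generalizing k with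
  | C c => rw [polyAct_C, polyAct_C]
  | add Q R hQ hR => simp only [polyAct_add, Pi.add_apply, hQ, hR]
  | monomial m c ih =>
    rw [pow_succ', mul_left_comm, polyAct_mul X, polyAct_mul X, polyAct_X, polyAct_X, ih, add_assoc]

lemma polyAct_pow (Q : ℤ[X]) (x : ℝ) (k : ℕ) :
    polyAct Q (fun j => x ^ j) k = aeval x Q * x ^ k := by
  induction Q using Polynomial.induction_on generalizing k with
  | C c => rw [polyAct_C, aeval_C]; rfl
  | add Q R hQ hR => simp only [polyAct_add, Pi.add_apply, hQ, hR, map_add, add_mul]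
  | monomial m c ih =>
    rw [pow_succ', mul_left_comm, polyAct_mul, polyAct_X, ih, map_mul (aeval x) X, aeval_X]
    ring

lemma polyAct_sum_pow {ι : Type*} (s : Finset ι) (Q : ℤ[X]) (c x : ι → ℝ) (k : ℕ) :
    polyAct Q (fun j => ∑ i ∈ s, c i * x i ^ j) k = ∑ i ∈ s, c i * (aeval (x i) Q * x i ^ k) := by
  have h : (fun j => ∑ i ∈ s, c i * x i ^ j) = ∑ i ∈ s, c i • (fun j : ℕ => x i ^ j) := by
    ext j
    simp
  rw [h, map_sum, Finset.sum_apply]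
  exact Finset.sum_congr rfl fun i _ => by
    rw [map_smul, Pi.smul_apply, polyAct_pow, smul_eq_mul]

lemma polyAct_int (Q : ℤ[X]) (u : ℕ → ℝ) (K : ℕ) (hu : ∀ k, K ≤ k → ∃ z : ℤ, u k = z) :
    ∀ k, K ≤ k → ∃ z : ℤ, polyAct Q u k = z := by
  induction Q using Polynomial.induction_on with
  | C c =>
    intro k hk
    obtain ⟨z, hz⟩ := hu k hk
    exact ⟨c * z, by rw [polyAct_C, hz]; push_cast; rfl⟩
  | add Q R hQ hR =>
    intro k hk
    obtain ⟨y, hy⟩ := hQ k hk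
    obtain ⟨z, hz⟩ := hR k hk
    exact ⟨y + z, by rw [polyAct_add, Pi.add_apply, hy, hz]; push_cast; rfl⟩
  | monomial m c ih =>
    intro k hk
    obtain ⟨z, hz⟩ := ih (k + 1) (by omega)
    exact ⟨z, by rw [pow_succ', mul_left_comm, polyAct_mul, polyAct_X, hz]⟩

/-- The constant depends on `Q` alone, which keeps the later estimates uniform in the sequence. -/
lemma polyAct_bounded (Q : ℤ[X]) : ∃ A : ℝ, ∀ (B : ℝ) (u : ℕ → ℝ), (∀ k, |u k| ≤ B) →
    ∀ k, |polyAct Q u k| ≤ A * B := by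
  induction Q using Polynomial.induction_on with
  | C c =>
    refine ⟨|(c : ℝ)|, fun B u hu k => ?_⟩
    rw [polyAct_C, abs_mul]
    exact mul_le_mul_of_nonneg_left (hu k) (abs_nonneg _)
  | add Q R hQ hR =>
    obtain ⟨A, hA⟩ := hQ
    obtain ⟨A', hA'⟩ := hR
    refine ⟨A + A', fun B u hu k => ?_⟩
    rw [polyAct_add, Pi.add_apply, add_mul]
    exact (abs_add_le _ _).trans (add_le_add (hA B u hu k) (hA' B u hu k))
  | monomial m c ih =>
    obtain ⟨A, hA⟩ := ih
    refine ⟨A, fun B u hu k => ?_⟩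
    rw [pow_succ', mul_left_comm, polyAct_mul, polyAct_X]
    exact hA B u hu (k + 1)

/-! ### Approximate inversion on bounded sequences -/

/-- If `a u k - b u (k + 1)` is small for the first `r` indices, then so is `u 0`. -/
lemma abs_zero_le_of_linear_small {a b : ℤ} (h : |b| < a) (r : ℕ) {B δ : ℝ} (hδ : 0 ≤ δ)
    (u : ℕ → ℝ) (hu : ∀ k, |u k| ≤ B)
    (hs : ∀ k < r, |(a : ℝ) * u k - b * u (k + 1)| ≤ δ) :
    |u 0| ≤ r * δ + |(b : ℝ) / a| ^ r * B := by
  have ha : (1 : ℝ) ≤ a := by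
    have : (1 : ℤ) ≤ a := by have := abs_nonneg b; omega
    exact_mod_cast this
  have hθ : |(b : ℝ) / a| ≤ 1 := by
    rw [abs_div, abs_of_pos (by linarith : (0 : ℝ) < a), div_le_one (by linarith)]
    exact_mod_cast h.le
  induction r generalizing u with
  | zero => simpa using hu 0
  | succ r ih =>
    have h1 := ih (fun k => u (k + 1)) (fun k => hu _) fun k hk => hs (k + 1) (by omega)
    have h0 := hs 0 (by omega)
    have e : u 0 = (a * u 0 - b * u (0 + 1)) / a + b / a * u (0 + 1) := by field_simp; ring
    have h2 : |((a : ℝ) * u 0 - b * u (0 + 1)) / a| ≤ δ := by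
      rw [abs_div, abs_of_pos (by linarith : (0 : ℝ) < a)]
      exact (div_le_self (abs_nonneg _) ha).trans h0
    have h3 : |(b : ℝ) / a * u (0 + 1)| ≤ r * δ + |(b : ℝ) / a| ^ (r + 1) * B := by
      rw [abs_mul]
      calc |(b : ℝ) / a| * |u (0 + 1)| ≤ |(b : ℝ) / a| * (r * δ + |(b : ℝ) / a| ^ r * B) :=
            mul_le_mul_of_nonneg_left h1 (abs_nonneg _)
        _ = |(b : ℝ) / a| * (r * δ) + |(b : ℝ) / a| ^ (r + 1) * B := by ring
        _ ≤ _ := by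
          exact add_le_add_left (mul_le_of_le_one_left (by positivity) hθ) _
    rw [e]
    refine (abs_add_le _ _).trans ((add_le_add h2 h3).trans (le_of_eq ?_))
    push_cast
    ring

/-- The length `r` is fixed first, to make the geometric term small, and then `δ`; neither depends
on `u`. -/
lemma exists_abs_zero_le_of_linear_small {a b : ℤ} (h : |b| < a) (B : ℝ) {ε : ℝ} (hε : 0 < ε) :
    ∃ (r : ℕ) (δ : ℝ), 0 < δ ∧ ∀ u : ℕ → ℝ, (∀ k, |u k| ≤ B) →
      (∀ k < r, |(a : ℝ) * u k - b * u (k + 1)| ≤ δ) → |u 0| ≤ ε := by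
  have ha : (0 : ℝ) < a := by exact_mod_cast (abs_nonneg b).trans_lt h
  have hθ : |(b : ℝ) / a| < 1 := by
    rw [abs_div, abs_of_pos ha, div_lt_one ha]
    exact_mod_cast h
  have ht : Tendsto (fun r : ℕ => |(b : ℝ) / a| ^ r * B) atTop (nhds 0) := by
    simpa using (tendsto_pow_atTop_nhds_zero_of_lt_one (abs_nonneg _) hθ).mul_const B
  obtain ⟨r, hr⟩ := (ht.eventually (gt_mem_nhds (half_pos hε))).exists
  refine ⟨r, ε / 2 / (r + 1), by positivity, fun u hu hs => ?_⟩
  have h1 := abs_zero_le_of_linear_small h r (by positivity) u hu hs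
  have h2 : (r : ℝ) * (ε / 2 / (r + 1)) ≤ ε / 2 := by
    rw [mul_div_assoc', div_le_iff₀ (by positivity)]
    nlinarith
  linarith

lemma linProd_insert {ι : Type*} [DecidableEq ι] (p q : ι → ℤ) {s : Finset ι} {a : ι}
    (ha : a ∉ s) : linProd p q (insert a s) = linProd p q s * (C (p a) - C (q a) * X) := by
  rw [linProd, Finset.prod_insert ha, mul_comm, linProd]

/-- A bounded sequence killed by `∏ (p i - q i S)` on a long initial segment starts with a
small term. -/
lemma exists_abs_zero_le_of_linProd_eq_zero {ι : Type*} (p q : ι → ℤ) (hpq : ∀ i, |q i| < p i)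
    (s : Finset ι) (B : ℝ) {ε : ℝ} (hε : 0 < ε) :
    ∃ m : ℕ, ∀ u : ℕ → ℝ, (∀ k, |u k| ≤ B) →
      (∀ k < m, polyAct (linProd p q s) u k = 0) → |u 0| ≤ ε := by
  classical
  induction s using Finset.induction_on generalizing B ε with
  | empty =>
    refine ⟨1, fun u _ h => ?_⟩
    have := h 0 one_pos
    rw [linProd, Finset.prod_empty, polyAct_one] at this
    rw [this, abs_zero]
    exact hε.le
  | insert a s ha ih =>
    obtain ⟨r, δ, hδ, hr⟩ := exists_abs_zero_le_of_linear_small (hpq a) B hε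
    obtain ⟨A, hA⟩ := polyAct_bounded (C (p a) - C (q a) * X)
    obtain ⟨m, hm⟩ := ih (A * B) hδ
    -- Each of the first `r` terms of the image under the new factor starts a segment of length `m`
    -- killed by the other factors.
    refine ⟨m + r, fun u hu h => hr u hu fun k hk => ?_⟩
    rw [← polyAct_linear]
    refine hm (fun j => polyAct (C (p a) - C (q a) * X) u (k + j)) (fun j => hA B u hu _)
      fun j hj => ?_
    rw [polyAct_shift, ← polyAct_mul, ← linProd_insert p q ha]
    exact h _ (by omega)

/-- If `∏ (p i - q i S)` kills a bounded sequence on a long segment `1, …, m`, then its value at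
`0` is nearly `∏ p i` times the first term. -/
lemma exists_abs_prod_mul_sub_le {ι : Type*} (p q : ι → ℤ) (hpq : ∀ i, |q i| < p i)
    (s : Finset ι) (B : ℝ) {ε : ℝ} (hε : 0 < ε) :
    ∃ m : ℕ, ∀ u : ℕ → ℝ, (∀ k, |u k| ≤ B) →
      (∀ k < m, polyAct (linProd p q s) u (k + 1) = 0) →
      |(∏ i ∈ s, (p i : ℝ)) * u 0 - polyAct (linProd p q s) u 0| ≤ ε := by
  classical
  induction s using Finset.induction_on generalizing B ε with
  | empty =>
    refine ⟨0, fun u _ _ => ?_⟩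
    simpa [linProd, polyAct_one] using hε.le
  | insert a s ha ih =>
    obtain ⟨A, hA⟩ := polyAct_bounded (C (p a) - C (q a) * X)
    obtain ⟨m, hm⟩ := ih (A * B) (half_pos hε)
    set P := ∏ i ∈ s, (p i : ℝ) with hP
    -- Adding the factor `a` creates the error `P * q a * u 1`; this bound on `u 1` keeps it below
    -- `ε / 2`.
    have hδ : 0 < ε / 2 / (|P * q a| + 1) := by positivity
    obtain ⟨m', hm'⟩ := exists_abs_zero_le_of_linProd_eq_zero p q hpq (insert a s) B hδ
    refine ⟨max m m', fun u hu h => ?_⟩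
    have h1 := hm (polyAct (C (p a) - C (q a) * X) u) (hA B u hu) fun k hk => by
      rw [← polyAct_mul, ← linProd_insert p q ha]
      exact h k (lt_max_of_lt_left hk)
    have h2 := hm' (fun j => u (1 + j)) (fun k => hu _) fun k hk => by
      rw [polyAct_shift, add_comm]
      exact h k (lt_max_of_lt_right hk)
    rw [← polyAct_mul, ← linProd_insert p q ha, polyAct_linear] at h1
    have h3 : |P * q a * u 1| ≤ ε / 2 := by
      rw [abs_mul]
      rw [le_div_iff₀ (by positivity)] at h2
      simp only [add_zero] at h2
      nlinarith [abs_nonneg (u 1)]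
    rw [Finset.prod_insert ha]
    have e : (p a : ℝ) * P * u 0 - polyAct (linProd p q (insert a s)) u 0 =
        (P * (p a * u 0 - q a * u (0 + 1)) - polyAct (linProd p q (insert a s)) u 0) +
          P * q a * u 1 := by
      simp only [zero_add]; ring
    rw [e]
    linarith [abs_add_le (P * (p a * u 0 - q a * u (0 + 1)) -
      polyAct (linProd p q (insert a s)) u 0) (P * q a * u 1)]

/-! ### Words in a non-periodic sequence -/

/-- A sequence with finitely many values which is not eventually periodic has, arbitrarily far
out, congruent positions followed by equal words but carrying different letters. -/
lemma exists_agree_of_not_eventually_periodic {α : Type*} (s : ℕ → α) (hs : (Set.range s).Finite)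
    (hper : ¬ ∃ d K : ℕ, 0 < d ∧ ∀ k, K ≤ k → s (k + d) = s k) {M : ℕ} (hM : 0 < M) (m K : ℕ) :
    ∃ k k' : ℕ, K ≤ k ∧ K ≤ k' ∧ k % M = k' % M ∧ (∀ j < m, s (k + 1 + j) = s (k' + 1 + j)) ∧
      s k ≠ s k' := by
  by_contra! hdet
  refine hper ?_
  have : Finite (Set.range s) := hs
  -- A finite state: the residue and the next `m` letters. If the claim fails, the state at `k + 1`
  -- determines the state at `k`, so the dynamics is deterministic backwards.
  let w : ℕ → Fin M × (Fin m → Set.range s) := fun k =>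
    (⟨k % M, Nat.mod_lt _ hM⟩, fun j => ⟨s (k + 1 + j), Set.mem_range_self _⟩)
  have hw : ∀ k k', w k = w k' ↔ k % M = k' % M ∧ ∀ j < m, s (k + 1 + j) = s (k' + 1 + j) := by
    intro k k'
    simp only [w, Prod.mk.injEq, Fin.mk.injEq, funext_iff, Subtype.mk.injEq, Fin.forall_iff]
  have hback : ∀ k k', K ≤ k → K ≤ k' → w k = w k' → s k = s k' := fun k k' hk hk' h =>
    hdet k k' hk hk' ((hw k k').1 h).1 ((hw k k').1 h).2
  have hstep : ∀ k k', K ≤ k → K ≤ k' → w (k + 1) = w (k' + 1) → w k = w k' := by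
    intro k k' hk hk' h
    have h0 := hback _ _ (by omega) (by omega) h
    rw [hw] at h ⊢
    refine ⟨Nat.ModEq.add_right_cancel' 1 h.1, fun j hj => ?_⟩
    rcases j with _ | j
    · exact h0
    · have := h.2 j (by omega)
      rwa [show k + 1 + (j + 1) = k + 1 + 1 + j by ring,
        show k' + 1 + (j + 1) = k' + 1 + 1 + j by ring]
  have hdesc : ∀ t k k', K ≤ k → K ≤ k' → w (k + t) = w (k' + t) → w k = w k' := by
    intro t
    induction t with
    | zero => exact fun k k' _ _ h => h
    | succ t ih =>
      intro k k' hk hk' h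
      exact ih k k' hk hk' (hstep _ _ (by omega) (by omega) h)
  obtain ⟨v, hv⟩ := Finite.exists_infinite_fiber w
  have hinf : (w ⁻¹' {v}).Infinite := Set.infinite_coe_iff.1 hv
  obtain ⟨a, ha, hKa⟩ := hinf.exists_gt K
  obtain ⟨b, hb, hab⟩ := hinf.exists_gt a
  -- The gap between two visits to a state recurring infinitely often is a period: it propagates
  -- backwards from arbitrarily late visits `c`.
  refine ⟨b - a, K, by omega, fun k hk => ?_⟩
  obtain ⟨c, hc, hkc⟩ := hinf.exists_gt (k + b)
  simp only [Set.mem_preimage, Set.mem_singleton_iff] at ha hb hc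
  have hk2 : ∀ k, K ≤ k → k + (b - a) ≤ c → w (k + (b - a)) = w k := by
    intro i hi hic
    obtain ⟨t, rfl⟩ := Nat.exists_eq_add_of_le hic
    refine hdesc t _ _ (by omega) hi ?_
    rw [hc]
    have h1 : w (i + t) = w a := by
      refine (hdesc (b - a) _ _ ?_ hKa.le ?_)
      · omega
      · rw [show i + t + (b - a) = i + (b - a) + t by ring, hc, show a + (b - a) = b by omega, hb]
    rw [h1, ha]
  exact hback _ _ (by omega) hk (hk2 k hk (by omega))

/-! ### Integrality obstruction and oscillation -/

/-- The exponent 0 makes `a` a nonzero integer, and by coprimality every power of the denominator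
divides it. -/
lemma den_eq_one_of_forall_mul_pow_int {x : ℚ} {a : ℝ} (ha : a ≠ 0)
    (h : ∀ k : ℕ, ∃ z : ℤ, a * (x : ℝ) ^ k = z) : x.den = 1 := by
  obtain ⟨N, hN⟩ := h 0
  rw [pow_zero, mul_one] at hN
  have hN0 : N ≠ 0 := by
    rintro rfl
    exact ha (by simpa using hN)
  have hdvd : ∀ k : ℕ, (x.den : ℤ) ^ k ∣ N := by
    intro k
    obtain ⟨z, hz⟩ := h k
    have hz' : (N : ℚ) * x ^ k = z := by
      rw [hN] at hz
      exact_mod_cast hz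
    have hd : (x.den : ℚ) ≠ 0 := by exact_mod_cast x.den_ne_zero
    have e : N * x.num ^ k = z * (x.den : ℤ) ^ k := by
      have hx : x * x.den = x.num := Rat.mul_den_eq_num x
      have : (N : ℚ) * (x.num : ℚ) ^ k = z * (x.den : ℚ) ^ k := by
        rw [← hx, mul_pow, ← mul_assoc, hz']
      exact_mod_cast this
    have hcop : IsCoprime ((x.den : ℤ) ^ k) (x.num ^ k) := by
      refine IsCoprime.pow ?_
      rw [Int.isCoprime_iff_gcd_eq_one, Int.gcd, Int.natAbs_natCast]
      exact x.reduced.symm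
    exact hcop.dvd_of_dvd_mul_right (Dvd.intro_left z e.symm)
  by_contra hne
  have h2 : 1 < x.den := by have := x.den_pos; omega
  have h3 := Int.natAbs_le_of_dvd_ne_zero (hdvd N.natAbs) hN0
  rw [Int.natAbs_pow, Int.natAbs_natCast] at h3
  exact absurd h3 (not_le.2 (Nat.lt_pow_self h2))

/-- A lower bound for the oscillation of a bounded sequence from pairs of distant values. -/
lemma le_limsup_sub_liminf {f : ℕ → ℝ} {A B c : ℝ} (hA : ∀ k, A ≤ f k) (hB : ∀ k, f k ≤ B)
    (h : ∀ ε > 0, ∀ K, ∃ k ≥ K, ∃ k' ≥ K, c - ε ≤ |f k - f k'|) :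
    c ≤ limsup f atTop - liminf f atTop := by
  by_contra! hlt
  set L := limsup f atTop
  set l := liminf f atTop
  set ε := (c - (L - l)) / 4 with hε
  have hε0 : 0 < ε := by rw [hε]; linarith
  have h1 : ∀ᶠ k in atTop, f k < L + ε :=
    eventually_lt_of_limsup_lt (by linarith) (isBoundedUnder_of ⟨B, hB⟩)
  have h2 : ∀ᶠ k in atTop, l - ε < f k :=
    eventually_lt_of_lt_liminf (by linarith) (isBoundedUnder_of ⟨A, hA⟩)
  obtain ⟨K, hK⟩ := eventually_atTop.1 (h1.and h2)
  obtain ⟨k, hk, k', hk', hkk⟩ := h ε hε0 K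
  have a1 := hK k hk
  have a2 := hK k' hk'
  have : |f k - f k'| < L - l + 2 * ε := abs_lt.2 ⟨by linarith [a1.2, a2.1], by linarith [a1.1, a2.2]⟩
  linarith

/-- Under the hypotheses of `theorem1p1`, the power sum is not eventually periodic modulo `1`. -/
lemma not_forall_sub_int {n : ℕ} (hn : 0 < n) (ξ : Fin n → ℝ) (p q : Fin n → ℤ)
    (hξ : ∀ i, ξ i ≠ 0) (hq : ∀ i, 0 < |q i|) (hpq : ∀ i, |q i| < p i)
    (hdist : Function.Injective fun i => (p i : ℝ) / (q i : ℝ))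
    (hfirst : Irrational (ξ ⟨0, hn⟩) ∨
      ¬ ∃ m : ℤ, (p ⟨0, hn⟩ : ℝ) / (q ⟨0, hn⟩ : ℝ) = (m : ℝ))
    {d : ℕ} (hd : 0 < d) (K : ℕ)
    (h : ∀ k, K ≤ k → ∃ z : ℤ, (∑ i, ξ i * ((p i : ℝ) / q i) ^ (k + d)) -
      (∑ i, ξ i * ((p i : ℝ) / q i) ^ k) = z) : False := by
  set o : Fin n := ⟨0, hn⟩ with ho
  have hq0 : ∀ i, (q i : ℝ) ≠ 0 := fun i => by exact_mod_cast abs_pos.1 (hq i)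
  set y : Fin n → ℚ := fun i => (p i : ℚ) / q i with hy
  have hyr : ∀ i, ((p i : ℝ) / q i) = (y i : ℝ) := fun i => by simp [hy]
  have habs : 1 < |y o| := by
    have h0 : (0 : ℚ) < |(q o : ℚ)| := by exact_mod_cast hq o
    have h1 : |(q o : ℚ)| < (p o : ℚ) := by exact_mod_cast hpq o
    rw [hy, abs_div, one_lt_div h0]
    exact h1.trans_le (le_abs_self _)
  have hy0 : y o ≠ 0 := fun h => by rw [h, abs_zero] at habs; linarith
  have hyd : y o ^ d - 1 ≠ 0 := by
    intro h
    have h2 : |y o| ^ d = 1 := by rw [← abs_pow, sub_eq_zero.1 h, abs_one]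
    exact absurd h2 (one_lt_pow₀ habs hd.ne').ne'
  set R : ℚ := ∏ i ∈ Finset.univ.erase o, ((p i : ℚ) - q i * y o) with hR
  have haev : ∀ x : ℝ, aeval x (linProd p q (Finset.univ.erase o)) =
      ∏ i ∈ Finset.univ.erase o, ((p i : ℝ) - q i * x) := by
    intro x
    rw [linProd, map_prod]
    exact Finset.prod_congr rfl fun i _ => by simp
  have hR0 : R ≠ 0 := by
    refine Finset.prod_ne_zero_iff.2 fun i hi h0 => (Finset.mem_erase.1 hi).1 (hdist ?_)
    have hqi : (q i : ℚ) ≠ 0 := by exact_mod_cast abs_pos.1 (hq i)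
    have : y i = y o := by
      rw [hy]
      simp only
      rw [div_eq_iff hqi]
      linear_combination h0
    simp only [hyr, this]
  -- The factors with index other than `o` annihilate every term of the integer sequence y_{k+d} -
  -- y_k except the one at `o`; distinctness of the ratios gave `R ≠ 0`.
  have key : ∀ k, K ≤ k → ∃ z : ℤ, ξ o * (((y o ^ d - 1) * R * y o ^ k : ℚ) : ℝ) = z := by
    intro k hk
    have hint := polyAct_int (linProd p q (Finset.univ.erase o))
      (fun k => ∑ i, (ξ i * ((y i : ℝ) ^ d - 1)) * (y i : ℝ) ^ k) K (fun k hk => by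
        obtain ⟨z, hz⟩ := h k hk
        refine ⟨z, ?_⟩
        rw [← hz, ← Finset.sum_sub_distrib]
        refine Finset.sum_congr rfl fun i _ => ?_
        rw [hyr]
        ring) k hk
    obtain ⟨z, hz⟩ := hint
    refine ⟨z, ?_⟩
    rw [polyAct_sum_pow, Finset.sum_eq_single o, haev] at hz
    · rw [← hz, hR]
      push_cast
      ring
    · intro i _ hi
      rw [haev, Finset.prod_eq_zero (Finset.mem_erase.2 ⟨hi, Finset.mem_univ i⟩)]
      · simp
      · rw [← hyr, mul_div_cancel₀ _ (hq0 i), sub_self]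
    · simp
  rcases hfirst with hirr | hnint
  · obtain ⟨z, hz⟩ := key K le_rfl
    have hne : (y o ^ d - 1) * R * y o ^ K ≠ 0 :=
      mul_ne_zero (mul_ne_zero hyd hR0) (pow_ne_zero _ hy0)
    exact (hirr.mul_ratCast hne).ne_int z hz
  · refine hnint ?_
    have hne : ξ o * (((y o ^ d - 1) * R * y o ^ K : ℚ) : ℝ) ≠ 0 := by
      refine mul_ne_zero (hξ o) ?_
      exact_mod_cast mul_ne_zero (mul_ne_zero hyd hR0) (pow_ne_zero _ hy0)
    have hden := den_eq_one_of_forall_mul_pow_int (x := y o) hne fun k => by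
      obtain ⟨z, hz⟩ := key (K + k) (by omega)
      refine ⟨z, ?_⟩
      rw [← hz]
      push_cast
      ring
    refine ⟨(y o).num, ?_⟩
    rw [hyr]
    exact_mod_cast ((Rat.den_eq_one_iff _).1 hden).symm

/-! ### Oscillation of the fractional parts along a residue class -/

theorem theorem1p1 (n : ℕ) (hn : 0 < n) (ξ : Fin n → ℝ) (p q : Fin n → ℤ)
    (hξ : ∀ i, ξ i ≠ 0)
    (hq : ∀ i, 0 < |q i|)
    (hpq : ∀ i, |q i| < p i)
    (hdist : Function.Injective fun i => (p i : ℝ) / (q i : ℝ))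
    (hfirst : Irrational (ξ ⟨0, hn⟩) ∨
      ¬ ∃ m : ℤ, (p ⟨0, hn⟩ : ℝ) / (q ⟨0, hn⟩ : ℝ) = (m : ℝ))
    (M : ℕ) (hM : 1 ≤ M) :
    ∃ l : ℤ,
      1 / (∏ i, (p i : ℝ)) ≤
        limsup (fun k : ℕ =>
          Int.fract (∑ i, ξ i * ((p i : ℝ) / (q i : ℝ)) ^ ((k : ℤ) * (M : ℤ) + l))) atTop -
        liminf (fun k : ℕ =>
          Int.fract (∑ i, ξ i * ((p i : ℝ) / (q i : ℝ)) ^ ((k : ℤ) * (M : ℤ) + l))) atTop := by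
  have hq0 : ∀ i, (q i : ℝ) ≠ 0 := fun i => by exact_mod_cast abs_pos.1 (hq i)
  have hp0 : ∀ i, (0 : ℝ) < p i := fun i => by exact_mod_cast (hq i).trans (hpq i)
  set P := ∏ i, (p i : ℝ) with hP
  have hP0 : 0 < P := Finset.prod_pos fun i _ => hp0 i
  set y : ℕ → ℝ := fun k => ∑ i, ξ i * ((p i : ℝ) / q i) ^ k with hy
  set e : ℕ → ℝ := fun k => Int.fract (y k) with he
  set T := linProd p q Finset.univ with hT
  have hTy : ∀ k, polyAct T y k = 0 := by
    intro k
    rw [hy, polyAct_sum_pow]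
    refine Finset.sum_eq_zero fun i _ => ?_
    have : aeval ((p i : ℝ) / q i) T = 0 := by
      rw [hT, linProd, map_prod]
      refine Finset.prod_eq_zero (Finset.mem_univ i) ?_
      simp [mul_div_cancel₀ _ (hq0 i)]
    rw [this, zero_mul, mul_zero]
  have hTe : ∀ k, ∃ z : ℤ, polyAct T e k = z := by
    intro k
    obtain ⟨z, hz⟩ := polyAct_int T (fun k => (⌊y k⌋ : ℝ)) 0 (fun k _ => ⟨_, rfl⟩) k (Nat.zero_le k)
    have h1 : e = y - fun k => (⌊y k⌋ : ℝ) := by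
      ext k
      exact (Int.self_sub_floor (y k)).symm
    refine ⟨-z, ?_⟩
    rw [h1, map_sub, Pi.sub_apply, hTy, hz]
    simp
  choose s hs using hTe
  have hsfin : (Set.range s).Finite := by
    obtain ⟨A, hA⟩ := polyAct_bounded T
    refine (Set.finite_Icc (-⌈A⌉) ⌈A⌉).subset ?_
    rintro _ ⟨k, rfl⟩
    have h1 := hA 1 e (fun k => by
      rw [abs_of_nonneg (Int.fract_nonneg _)]
      exact (Int.fract_lt_one _).le) k
    rw [hs, mul_one] at h1
    have h2 := abs_le.1 (h1.trans (Int.le_ceil A))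
    exact ⟨by exact_mod_cast h2.1, by exact_mod_cast h2.2⟩
  have hediff : ∀ a b, |e a - e b| ≤ 1 := fun a b => by
    have h1 := Int.fract_nonneg (y a)
    have h2 := Int.fract_lt_one (y a)
    have h3 := Int.fract_nonneg (y b)
    have h4 := Int.fract_lt_one (y b)
    simp only [he]
    exact abs_le.2 ⟨by linarith, by linarith⟩
  have hTd : ∀ a b k, polyAct T (fun j => e (a + j) - e (b + j)) k = s (a + k) - s (b + k) := by
    intro a b k
    rw [← hs, ← hs, ← polyAct_shift, ← polyAct_shift, ← Pi.sub_apply, ← map_sub]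
    rfl
  have hper : ¬ ∃ d K : ℕ, 0 < d ∧ ∀ k, K ≤ k → s (k + d) = s k := by
    rintro ⟨d, K, hd, hdK⟩
    refine not_forall_sub_int hn ξ p q hξ hq hpq hdist hfirst hd K fun k hk => ?_
    have hee : e (k + d) = e k := by
      -- T kills the difference of the two tails at every index, so its first term is below every
      -- `ε`.
      refine sub_eq_zero.1 (abs_nonpos_iff.1 (le_of_forall_pos_le_add fun ε hε => ?_))
      obtain ⟨m, hm⟩ := exists_abs_zero_le_of_linProd_eq_zero p q hpq Finset.univ 1 hε
      rw [zero_add]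
      refine hm (fun j => e (k + d + j) - e (k + j)) (fun j => hediff _ _) fun j _ => ?_
      rw [hTd, add_right_comm, hdK _ (by omega), sub_self]
    refine ⟨⌊y (k + d)⌋ - ⌊y k⌋, ?_⟩
    have h1 := Int.floor_add_fract (y (k + d))
    have h2 := Int.floor_add_fract (y k)
    simp only [he] at hee
    push_cast
    change y (k + d) - y k = _
    linarith
  have hpair : ∀ N : ℕ, ∃ l : Fin M, ∃ k k' : ℕ, N ≤ k ∧ N ≤ k' ∧
      1 / P - 1 / (N + 1) ≤ |e (k * M + l) - e (k' * M + l)| := by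
    intro N
    -- The factor `P` is there so that division by `P` leaves the error 1/(N+1).
    have hε : 0 < P * (1 / ((N : ℝ) + 1)) := by positivity
    obtain ⟨m, hm⟩ := exists_abs_prod_mul_sub_le p q hpq Finset.univ 1 hε
    obtain ⟨k, k', hk, hk', hmod, hword, hne⟩ :=
      exists_agree_of_not_eventually_periodic s hsfin hper hM m (N * M)
    refine ⟨⟨k % M, Nat.mod_lt _ hM⟩, k / M, k' / M, (Nat.le_div_iff_mul_le hM).2 hk,
      (Nat.le_div_iff_mul_le hM).2 hk', ?_⟩
    have h1 : k / M * M + k % M = k := Nat.div_add_mod' k M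
    have h2 : k' / M * M + k % M = k' := by rw [hmod]; exact Nat.div_add_mod' k' M
    simp only [h1, h2]
    have h3 := hm (fun j => e (k + j) - e (k' + j)) (fun j => hediff _ _) fun j hj => by
      have := hword j hj
      rw [hTd, add_comm j 1, ← add_assoc, ← add_assoc, this, sub_self]
    rw [hTd] at h3
    simp only [add_zero] at h3
    have h4 : (1 : ℝ) ≤ |(s k : ℝ) - s k'| := by
      exact_mod_cast Int.one_le_abs (sub_ne_zero.2 hne)
    have h5 : 1 ≤ P * |e k - e k'| + P * (1 / ((N : ℝ) + 1)) := by
      rw [← abs_of_pos hP0, ← abs_mul, abs_of_pos hP0]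
      have := abs_sub_abs_le_abs_sub ((s k : ℝ) - s k') (P * (e k - e k'))
      rw [abs_sub_comm] at h3
      linarith
    rw [← mul_add, ← div_le_iff₀' hP0] at h5
    linarith
  choose l hl using hpair
  have : Nonempty (Fin M) := ⟨⟨0, hM⟩⟩
  -- The residue found depends on `N`; by pigeonhole one residue serves infinitely many `N`.
  obtain ⟨v, hv⟩ := Finite.exists_infinite_fiber l
  have hinf : (l ⁻¹' {v}).Infinite := Set.infinite_coe_iff.1 hv
  refine ⟨((v : ℕ) : ℤ), ?_⟩
  have hf : (fun k : ℕ => Int.fract (∑ i, ξ i * ((p i : ℝ) / (q i : ℝ)) ^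
      ((k : ℤ) * (M : ℤ) + ((v : ℕ) : ℤ)))) = fun k : ℕ => e (k * M + v) := by
    ext k
    simp only [he, hy]
    congr 1
  rw [hf]
  refine le_limsup_sub_liminf (fun k => Int.fract_nonneg _) (fun k => (Int.fract_lt_one _).le)
    fun ε hε K => ?_
  obtain ⟨N₀, hN₀⟩ := exists_nat_one_div_lt hε
  obtain ⟨N, hN, hNK⟩ := hinf.exists_gt (max N₀ K)
  obtain ⟨k, k', hk, hk', hkk⟩ := hl N
  have hNv : l N = v := hN
  rw [hNv] at hkk
  refine ⟨k, by omega, k', by omega, le_trans ?_ hkk⟩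
  have : 1 / ((N : ℝ) + 1) ≤ 1 / ((N₀ : ℝ) + 1) := by
    have : (N₀ : ℝ) ≤ N := by exact_mod_cast (by omega : N₀ ≤ N)
    gcongr
  linarith
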